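/- Let $n\ge 0$ be an integer. A *small cover over the cube* $I^n=[0,1]^n$ is a closed (compact, without boundary) smooth $n$-manifold $M$ with a smooth action of $\mathbb{Z}_2^n$ such that 1. the action is locally standard: every point of $M$ lies in a $\mathbb{Z}_2^n$-invariant open set $V$ for which there are an automorphism $\theta$ of $\mathbb{Z}_2^n$, an open set $U\subseteq\mathbb{R}^n$ invariant under the standard action of $\mathbb{Z}_2^n$ by sign changes of the coordinates, and a diffeomorphism $f:V\to U$ with $f(t\cdot y)=\theta(t)\cdot f(y)$ for all $t\in\mathbb{Z}_2^n$, $y\in V$; 2. the orbit space is $I^n$: there is a homeomorphism $M/\mathbb{Z}_2^n\cong I^n$ that respects the face structures, i.e. the orbit of $x$ is sent into the relative interior of a face of codimension $k$ exactly when the isotropy group of $x$ has order $2^k$. Two small covers $M_1,M_2$ over $I^n$ are *weakly $\mathbb{Z}_2^n$-equivariantly homeomorphic* if there are an automorphism $\varphi$ of $\mathbb{Z}_2^n$ and a homeomorphism $f:M_1\to M_2$ with $f(t\cdot x)=\varphi(t)\cdot f(x)$ for all $t\in\mathbb{Z}_2^n$ and $x\in M_1$. A *digraph* on a set of nodes has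 at most one edge from $i$ to $j$ for each ordered pair $(i,j)$ of nodes; it is *acyclic* if it has no directed cycle of any length (in particular no loop). **Theorem.** For every $n$, the number of weakly $\mathbb{Z}_2^n$-equivariant homeomorphism classes of small covers over $I^n$ is finite and less than or equal to the number of acyclic digraphs with $n$ unlabeled nodes, i.e. the number of isomorphism classes of acyclic digraphs with $n$ nodes. -/

import Mathlib

open scoped Manifold ContDiff

/-- The group `ℤ₂ⁿ`, written additively. -/
abbrev Z2Pow (n : ℕ) : Type := Fin n → ZMod 2

/-- The standard action of `ℤ₂ⁿ` on `ℝⁿ`: the `i`-th generator changes the sign of the `i`-th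
coordinate. -/
noncomputable def stdReflect {n : ℕ} (t : Z2Pow n) (v : EuclideanSpace ℝ (Fin n)) :
    EuclideanSpace ℝ (Fin n) :=
  WithLp.toLp 2 fun i => if t i = 0 then v i else -v i

/-- A `ℤ₂ⁿ`-action on a smooth `n`-manifold `M` is locally standard if every point lies in an
invariant open set which is diffeomorphic to an invariant open subset of `ℝⁿ`, equivariantly up to
an automorphism of `ℤ₂ⁿ`. The diffeomorphisms from open subsets of `M` onto open subsets of `ℝⁿ` are
exactly the members of the maximal smooth atlas. -/
def IsLocallyStandard (n : ℕ) (M : Type*) [TopologicalSpace M]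
    [ChartedSpace (EuclideanSpace ℝ (Fin n)) M] [AddAction (Z2Pow n) M] : Prop :=
  ∀ x : M, ∃ e ∈ IsManifold.maximalAtlas (𝓡 n) ∞ M, ∃ θ : Z2Pow n ≃+ Z2Pow n,
    x ∈ e.source ∧
    (∀ t : Z2Pow n, ∀ y ∈ e.source, t +ᵥ y ∈ e.source) ∧
    (∀ t : Z2Pow n, ∀ v ∈ e.target, stdReflect t v ∈ e.target) ∧
    (∀ t : Z2Pow n, ∀ y ∈ e.source, e (t +ᵥ y) = stdReflect (θ t) (e y))

/-- The cube `Iⁿ = [0,1]ⁿ`. -/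
abbrev UnitCube (n : ℕ) : Type := Fin n → unitInterval

/-- The codimension of the smallest face of `Iⁿ` that contains `q`, that is, the number of facets
`{q i = 0}`, `{q i = 1}` through `q`. -/
noncomputable def UnitCube.codim {n : ℕ} (q : UnitCube n) : ℕ :=
  {i : Fin n | q i = 0 ∨ q i = 1}.ncard

/-- The orbit space of the `ℤ₂ⁿ`-action on `M` is the polytope `Iⁿ`: there is a homeomorphism
`M / ℤ₂ⁿ ≅ Iⁿ` that respects the face structures (without this, all simple `n`-polytopes, being
homeomorphic to a ball, would be indistinguishable). The orbit space of a locally standard action is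
locally `ℝⁿ / ℤ₂ⁿ = [0,∞)ⁿ`, and the orbit of `x` lies in the relative interior of a face of
codimension `k`, that is, exactly `k` of its local coordinates vanish, if and only if the isotropy
group of `x` has order `2 ^ k`. -/
def OrbitSpaceIsCube (n : ℕ) (M : Type*) [TopologicalSpace M] [AddAction (Z2Pow n) M] : Prop :=
  ∃ h : Quotient (AddAction.orbitRel (Z2Pow n) M) ≃ₜ UnitCube n,
    ∀ x : M, Nat.card (AddAction.stabilizer (Z2Pow n) x) =
      2 ^ UnitCube.codim (h (Quotient.mk (AddAction.orbitRel (Z2Pow n) M) x))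

universe u

/-- A small cover over the cube `Iⁿ`: a closed smooth `n`-manifold with a smooth locally standard
action of `ℤ₂ⁿ` whose orbit space is `Iⁿ`. -/
structure SmallCover (n : ℕ) : Type (u + 1) where
  carrier : Type u
  [topology : TopologicalSpace carrier]
  [t2 : T2Space carrier]
  [compact : CompactSpace carrier]
  [charted : ChartedSpace (EuclideanSpace ℝ (Fin n)) carrier]
  [smooth : IsManifold (𝓡 n) ∞ carrier]
  [action : AddAction (Z2Pow n) carrier]
  smooth_vadd : ∀ t : Z2Pow n, ContMDiff (𝓡 n) (𝓡 n) ∞ fun x : carrier => t +ᵥ x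
  locallyStandard : IsLocallyStandard n carrier
  orbitSpace : OrbitSpaceIsCube n carrier

attribute [instance] SmallCover.topology SmallCover.t2 SmallCover.compact SmallCover.charted
  SmallCover.smooth SmallCover.action

/-- Weak `ℤ₂ⁿ`-equivariant homeomorphism. -/
def SmallCover.WeaklyHomeomorphic {n : ℕ} (M N : SmallCover.{u} n) : Prop :=
  ∃ (φ : Z2Pow n ≃+ Z2Pow n) (f : M.carrier ≃ₜ N.carrier),
    ∀ (t : Z2Pow n) (x : M.carrier), f (t +ᵥ x) = φ t +ᵥ f x

/-- Weak `ℤ₂ⁿ`-equivariant homeomorphism, as an equivalence relation on small covers over `Iⁿ`. -/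
def SmallCover.weakSetoid (n : ℕ) : Setoid (SmallCover.{u} n) where
  r := SmallCover.WeaklyHomeomorphic
  iseqv :=
    { refl := fun M => ⟨AddEquiv.refl _, Homeomorph.refl _, fun _ _ => rfl⟩
      symm := by
        rintro M N ⟨φ, f, h⟩
        refine ⟨φ.symm, f.symm, fun t y => f.injective ?_⟩
        rw [h]
        simp
      trans := by
        rintro M N K ⟨φ, f, h⟩ ⟨ψ, g, k⟩
        exact ⟨φ.trans ψ, f.trans g, fun t x => by simp [h, k]⟩ }

/-- The weakly `ℤ₂ⁿ`-equivariant homeomorphism classes of small covers over `Iⁿ`. -/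
def SmallCoverClass (n : ℕ) : Type (u + 1) := Quotient (SmallCover.weakSetoid.{u} n)

/-- A digraph is acyclic if it has no directed cycle of any length (in particular no loop). -/
def Digraph.IsAcyclic {V : Type*} (G : Digraph V) : Prop :=
  ∀ v : V, ¬ Relation.TransGen G.Adj v v

/-- Isomorphism (relabeling of the nodes) of acyclic digraphs with `n` labeled nodes. -/
def acyclicDigraphSetoid (n : ℕ) : Setoid {G : Digraph (Fin n) // G.IsAcyclic} where
  r G H := Nonempty (G.1.Adj ≃r H.1.Adj)
  iseqv :=
    { refl := fun _ => ⟨RelIso.refl _⟩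
      symm := fun ⟨e⟩ => ⟨e.symm⟩
      trans := fun ⟨e⟩ ⟨f⟩ => ⟨e.trans f⟩ }

/-- The acyclic digraphs with `n` unlabeled nodes. -/
def UnlabeledAcyclicDigraph (n : ℕ) : Type := Quotient (acyclicDigraphSetoid n)

/-! A small cover is determined by its isotropy data. The cube is contractible and the orbit map `π`
has local sections, so `π` has a global section `s` (`exists_section`), and every point is a
translate `t +ᵥ s q`, with `t` unique modulo the isotropy group at `s q`. That group is generated by
one vector for each facet through `q` (`exists_characteristic`). Two covers whose facet vectors
match under an automorphism of the group and a symmetry of the cube are therefore weakly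
homeomorphic (`exists_homeomorph`).

Let `b i` and `c i` be the vectors of the facets `q i = 0` and `q i = 1`. At each vertex the
isotropy is the whole group, so choosing one of `b i`, `c i` for every `i` always gives a spanning
family. With `b` as basis, this makes all principal minors of the matrix of `c` equal to 1. Over
`ZMod 2` such a matrix is the identity plus the adjacency matrix of an acyclic digraph
(`isAcyclic_digraph`). Since the diagonal is forced, the digraph determines the matrix, and a
relabeling of nodes is realized by permuting the coordinates of the cube
(`HasDigraph.weaklyHomeomorphic`). Sending each class to a digraph of one representative is thus
injective. -/

open Topology Set

/-! ### Connectedness and orbit maps onto the cube -/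

/-- A preconnected set that is covered by finitely many closed sets, pairwise disjoint on it, lies
in one of them. -/
theorem IsPreconnected.exists_subset_of_finite_closed_cover {α ι : Type*} [TopologicalSpace α]
    [Finite ι] {D : Set α} (hD : IsPreconnected D) (hne : D.Nonempty) (C : ι → Set α)
    (hC : ∀ t, IsClosed (C t)) (hcov : ∀ x ∈ D, ∃ t, x ∈ C t)
    (hdisj : ∀ x ∈ D, ∀ t t', x ∈ C t → x ∈ C t' → t = t') : ∃ t, D ⊆ C t := by
  obtain ⟨x₀, hx₀⟩ := hne
  obtain ⟨t₀, ht₀⟩ := hcov x₀ hx₀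
  refine ⟨t₀, fun x hx => ?_⟩
  by_contra hxt
  have hcl : IsClosed (⋃ t : {t : ι // t ≠ t₀}, C t) := isClosed_iUnion_of_finite fun t => hC t
  obtain ⟨t, ht⟩ := hcov x hx
  have htt : t ≠ t₀ := by rintro rfl; exact hxt ht
  obtain ⟨y, hy, hy₀, hy₁⟩ := isPreconnected_closed_iff.1 hD _ _ (hC t₀) hcl
    (fun y hy => by
      obtain ⟨t', ht'⟩ := hcov y hy
      by_cases h : t' = t₀
      · exact Or.inl (h ▸ ht')
      · exact Or.inr (mem_iUnion.2 ⟨⟨t', h⟩, ht'⟩))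
    ⟨x₀, hx₀, ht₀⟩ ⟨x, hx, mem_iUnion.2 ⟨⟨t, htt⟩, ht⟩⟩
  obtain ⟨⟨t', ht'⟩, hyt'⟩ := mem_iUnion.1 hy₁
  exact ht' (hdisj y hy _ _ hyt' hy₀)

/-- A map from a space with a `ℤ₂ⁿ`-action onto the cube `Iⁿ` that identifies the orbit space with
`Iⁿ` and respects the face structures. -/
structure IsCubeOrbitMap {n : ℕ} {X : Type*} [TopologicalSpace X] [AddAction (Z2Pow n) X]
    (π : X → UnitCube n) : Prop where
  isOpenQuotientMap : IsOpenQuotientMap π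
  eq_iff : ∀ x y, π x = π y ↔ ∃ t : Z2Pow n, t +ᵥ y = x
  card_stabilizer : ∀ x, Nat.card (AddAction.stabilizer (Z2Pow n) x) = 2 ^ (π x).codim

theorem OrbitSpaceIsCube.exists_isCubeOrbitMap {n : ℕ} {X : Type*} [TopologicalSpace X]
    [AddAction (Z2Pow n) X] [ContinuousConstVAdd (Z2Pow n) X] (H : OrbitSpaceIsCube n X) :
    ∃ π : X → UnitCube n, IsCubeOrbitMap π := by
  obtain ⟨h, hh⟩ := H
  refine ⟨fun x => h (Quotient.mk _ x), ?_, fun x y => ?_, hh⟩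
  · exact h.isOpenQuotientMap.comp AddAction.isOpenQuotientMap_quotientMk
  · rw [h.injective.eq_iff, Quotient.eq]
    exact AddAction.orbitRel_apply.trans AddAction.mem_orbit_iff

namespace IsCubeOrbitMap

variable {n : ℕ} {X : Type*} [TopologicalSpace X] [AddAction (Z2Pow n) X] {π : X → UnitCube n}

theorem vadd_eq (hπ : IsCubeOrbitMap π) (t : Z2Pow n) (x : X) : π (t +ᵥ x) = π x :=
  (hπ.eq_iff _ _).2 ⟨t, rfl⟩

/-- The action is free over the interior of the cube, where the codimension is 0. -/
theorem eq_zero_of_vadd_eq (hπ : IsCubeOrbitMap π) {x : X}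
    (hx : ∀ i, π x i ≠ 0 ∧ π x i ≠ 1) {t : Z2Pow n} (ht : t +ᵥ x = x) : t = 0 := by
  have h0 : (π x).codim = 0 := by
    have : {i : Fin n | π x i = 0 ∨ π x i = 1} = ∅ := by
      ext i; simp [hx i]
    simp [UnitCube.codim, this]
  have h1 := hπ.card_stabilizer x
  rw [h0, pow_zero, AddSubgroup.card_eq_one] at h1
  have : t ∈ AddAction.stabilizer (Z2Pow n) x := ht
  rwa [h1, AddSubgroup.mem_bot] at this

end IsCubeOrbitMap

/-! ### Local sections of the orbit map -/

/-- The coordinatewise absolute value is a standard reflection of the vector. -/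
theorem exists_stdReflect_eq_abs {n : ℕ} (v : EuclideanSpace ℝ (Fin n)) :
    ∃ t : Z2Pow n, stdReflect t v = WithLp.toLp 2 fun i => |v i| := by
  refine ⟨fun i => if 0 ≤ v i then 0 else 1, ?_⟩
  unfold stdReflect
  congr 1
  ext i
  by_cases h : 0 ≤ v i
  · simp [h, abs_of_nonneg h]
  · simp [h, abs_of_neg (not_le.1 h)]

theorem abs_stdReflect {n : ℕ} (t : Z2Pow n) (v : EuclideanSpace ℝ (Fin n)) (i : Fin n) :
    |stdReflect t v i| = |v i| := by
  unfold stdReflect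
  simp only
  split_ifs <;> simp

/-- `π` has a continuous section over `A`. -/
def HasSectionOn {X Y : Type*} [TopologicalSpace X] [TopologicalSpace Y] (π : X → Y)
    (A : Set Y) : Prop :=
  ∃ s : Y → X, ContinuousOn s A ∧ ∀ q ∈ A, π (s q) = q

theorem HasSectionOn.mono {X Y : Type*} [TopologicalSpace X] [TopologicalSpace Y] {π : X → Y}
    {A B : Set Y} (h : HasSectionOn π B) (hAB : A ⊆ B) : HasSectionOn π A :=
  let ⟨s, hs, hs'⟩ := h
  ⟨s, hs.mono hAB, fun q hq => hs' q (hAB hq)⟩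

/-- The orbit map of a locally standard action has local sections. -/
theorem IsLocallyStandard.exists_hasSectionOn {n : ℕ} {X : Type*} [TopologicalSpace X]
    [ChartedSpace (EuclideanSpace ℝ (Fin n)) X] [AddAction (Z2Pow n) X]
    (hX : IsLocallyStandard n X) {π : X → UnitCube n} (hπ : IsCubeOrbitMap π) (q : UnitCube n) :
    ∃ U, IsOpen U ∧ q ∈ U ∧ HasSectionOn π U := by
  obtain ⟨x, rfl⟩ := hπ.isOpenQuotientMap.surjective q
  obtain ⟨e, -, θ, hx, hsrc, htgt, heq⟩ := hX x
  let a : EuclideanSpace ℝ (Fin n) → EuclideanSpace ℝ (Fin n) :=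
    fun v => WithLp.toLp 2 fun i => |v i|
  have ha : Continuous a := by
    refine (PiLp.continuous_toLp 2 _).comp (continuous_pi fun i => ?_)
    fun_prop
  have hat : ∀ v ∈ e.target, a v ∈ e.target := by
    intro v hv
    obtain ⟨t, ht⟩ := exists_stdReflect_eq_abs v
    have := htgt t v hv
    rwa [ht] at this
  -- In the chart, the absolute value picks the representative of each orbit in the closed positive
  -- orthant. So `r` is constant on orbits and descends to the section.
  let r : X → X := fun y => e.symm (a (e y))
  have hr : ContinuousOn r e.source :=
    e.continuousOn_symm.comp (ha.comp_continuousOn e.continuousOn)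
      fun y hy => hat _ (e.map_source hy)
  have hπr : ∀ y ∈ e.source, π (r y) = π y := by
    intro y hy
    obtain ⟨t, ht⟩ := exists_stdReflect_eq_abs (e y)
    have : r y = θ.symm t +ᵥ y := by
      have h1 := heq (θ.symm t) y hy
      rw [θ.apply_symm_apply, ht] at h1
      change e.symm (a (e y)) = _
      rw [show a (e y) = _ from h1.symm, e.left_inv (hsrc _ _ hy)]
    rw [this, hπ.vadd_eq]
  have hrr : ∀ y ∈ e.source, ∀ y', π y = π y' → r y' = r y := by
    intro y hy y' hyy
    obtain ⟨t, rfl⟩ := (hπ.eq_iff y' y).1 hyy.symm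
    have : a (e (t +ᵥ y)) = a (e y) := by
      rw [heq t y hy]
      change WithLp.toLp 2 _ = WithLp.toLp 2 _
      congr 1
      ext i
      exact abs_stdReflect _ _ i
    change e.symm (a (e (t +ᵥ y))) = _
    rw [this]
  obtain ⟨σ, hσ⟩ := hπ.isOpenQuotientMap.surjective.hasRightInverse
  have hσs : ∀ y ∈ e.source, σ (π y) ∈ e.source := by
    intro y hy
    obtain ⟨t, ht⟩ := (hπ.eq_iff (σ (π y)) y).1 (hσ _)
    exact ht ▸ hsrc t y hy
  refine ⟨π '' e.source, hπ.isOpenQuotientMap.isOpenMap _ e.open_source, ⟨x, hx, rfl⟩,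
    r ∘ σ, ?_, ?_⟩
  -- `σ` need not be continuous, but `r ∘ σ ∘ π = r` on the chart domain and `π` is open, so `r ∘ σ`
  -- inherits continuity from `r`.
  · rintro _ ⟨y, hy, rfl⟩
    refine ContinuousAt.continuousWithinAt ?_
    have h1 : r (σ (π y)) = r y := hrr y hy _ (hσ _).symm
    intro W hW
    have hW' : r ⁻¹' W ∩ e.source ∈ 𝓝 y := by
      refine Filter.inter_mem ?_ (e.open_source.mem_nhds hy)
      have := (hr y hy).continuousAt (e.open_source.mem_nhds hy)
      exact this (by simpa [h1] using hW)
    refine Filter.mem_map.2 (Filter.mem_of_superset (hπ.isOpenQuotientMap.isOpenMap.image_mem_nhds hW') ?_)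
    rintro _ ⟨z, ⟨hz, hzs⟩, rfl⟩
    have : r (σ (π z)) = r z := hrr z hzs _ (hσ _).symm
    simpa [this] using hz
  · rintro _ ⟨y, hy, rfl⟩
    change π (r (σ (π y))) = _
    rw [hπr _ (hσs y hy), hσ]

/-! ### Gluing local sections into a global one -/

namespace IsCubeOrbitMap

variable {n : ℕ} {X : Type*} [TopologicalSpace X] [T2Space X] [AddAction (Z2Pow n) X]
  [ContinuousConstVAdd (Z2Pow n) X] {π : X → UnitCube n}

/-- Sections over two boxes with a common facet can be glued after a translation of one of them. -/
theorem hasSectionOn_Icc_of_split (hπ : IsCubeOrbitMap π) {a b : UnitCube n}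
    (hab : ∀ j, a j < b j) {i : Fin n} {c : unitInterval} (hac : a i < c) (hcb : c < b i)
    (h₁ : HasSectionOn π (Icc a (Function.update b i c)))
    (h₂ : HasSectionOn π (Icc (Function.update a i c) b)) : HasSectionOn π (Icc a b) := by
  obtain ⟨s₁, hs₁, hπ₁⟩ := h₁
  obtain ⟨s₂, hs₂, hπ₂⟩ := h₂
  have mem₁ : ∀ q, q ∈ Icc a (Function.update b i c) ↔ q ∈ Icc a b ∧ q i ≤ c := by
    intro q
    simp only [mem_Icc, Pi.le_def]
    constructor
    · rintro ⟨h, h'⟩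
      have hi : q i ≤ c := by simpa using h' i
      refine ⟨⟨h, fun j => ?_⟩, hi⟩
      by_cases hj : j = i
      · subst hj; exact hi.trans hcb.le
      · simpa [hj] using h' j
    · rintro ⟨⟨h, h'⟩, hi⟩
      refine ⟨h, fun j => ?_⟩
      by_cases hj : j = i
      · subst hj; simpa using hi
      · simpa [hj] using h' j
  have mem₂ : ∀ q, q ∈ Icc (Function.update a i c) b ↔ q ∈ Icc a b ∧ c ≤ q i := by
    intro q
    simp only [mem_Icc, Pi.le_def]
    constructor
    · rintro ⟨h, h'⟩
      have hi : c ≤ q i := by simpa using h i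
      refine ⟨⟨fun j => ?_, h'⟩, hi⟩
      by_cases hj : j = i
      · subst hj; exact hac.le.trans hi
      · simpa [hj] using h j
    · rintro ⟨⟨h, h'⟩, hi⟩
      refine ⟨fun j => ?_, h'⟩
      by_cases hj : j = i
      · subst hj; simpa using hi
      · simpa [hj] using h j
  let K : Set (UnitCube n) := {q | q ∈ Icc a b ∧ q i = c}
  have hK : IsClosed K := isClosed_Icc.inter (isClosed_eq (continuous_apply i) continuous_const)
  have hK₁ : K ⊆ Icc a (Function.update b i c) := fun q hq => (mem₁ q).2 ⟨hq.1, hq.2.le⟩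
  have hK₂ : K ⊆ Icc (Function.update a i c) b := fun q hq => (mem₂ q).2 ⟨hq.1, hq.2.ge⟩
  -- The common facet `K` may touch the boundary of the cube, where the translation relating the two
  -- sections is not unique. Its relative interior `D` lies in the interior of the cube, so there
  -- the translation is unique, hence constant by connectedness. The identity then extends to `K` by
  -- closure.
  let D : Set (UnitCube n) := univ.pi fun j => if j = i then {c} else Ioo (a j) (b j)
  have hDpre : IsPreconnected D := isPreconnected_univ_pi fun j => by
    split_ifs
    · exact isPreconnected_singleton
    · exact isPreconnected_Ioo
  have hDne : D.Nonempty := univ_pi_nonempty_iff.2 fun j => by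
    split_ifs
    · exact singleton_nonempty _
    · exact nonempty_Ioo.2 (hab j)
  have hDcl : K ⊆ closure D := by
    rintro q ⟨hq, hqi⟩
    rw [closure_pi_set]
    intro j _
    dsimp only
    split_ifs with hj
    · subst hj; simp [hqi]
    · rw [closure_Ioo (hab j).ne]; exact ⟨hq.1 j, hq.2 j⟩
  have hDi : ∀ q ∈ D, q i = c := fun q hq => by simpa using hq i trivial
  have hDj : ∀ q ∈ D, ∀ j, a j < q j ∧ q j < b j := by
    intro q hq j
    by_cases hj : j = i
    · subst hj; rw [hDi q hq]; exact ⟨hac, hcb⟩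
    · simpa [hj] using hq j trivial
  have hDK : D ⊆ K := fun q hq =>
    ⟨⟨fun j => (hDj q hq j).1.le, fun j => (hDj q hq j).2.le⟩, hDi q hq⟩
  let C : Z2Pow n → Set (UnitCube n) := fun t => {q | q ∈ K ∧ s₁ q = t +ᵥ s₂ q}
  have hC : ∀ t, IsClosed (C t) := by
    intro t
    have : ContinuousOn (fun q => (s₁ q, t +ᵥ s₂ q)) K :=
      (hs₁.mono hK₁).prodMk ((hs₂.mono hK₂).const_vadd t)
    exact this.preimage_isClosed_of_isClosed hK isClosed_diagonal
  obtain ⟨t, ht⟩ := hDpre.exists_subset_of_finite_closed_cover hDne C hC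
    (fun q hq => by
      obtain ⟨t, ht⟩ := (hπ.eq_iff (s₁ q) (s₂ q)).1
        ((hπ₁ q (hK₁ (hDK hq))).trans (hπ₂ q (hK₂ (hDK hq))).symm)
      exact ⟨t, hDK hq, ht.symm⟩)
    (fun q hq t t' ht ht' => by
      have h : (-t' + t) +ᵥ s₂ q = s₂ q := by
        rw [add_vadd, ← ht.2, ht'.2, neg_vadd_vadd]
      have := hπ.eq_zero_of_vadd_eq (fun j => by
        rw [hπ₂ q (hK₂ (hDK hq))]
        exact ⟨((hDj q hq j).1.trans_le' unitInterval.nonneg').ne',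
          ((hDj q hq j).2.trans_le unitInterval.le_one').ne⟩) h
      exact (neg_add_eq_zero.1 this).symm)
  have hKt : ∀ q ∈ K, s₁ q = t +ᵥ s₂ q := fun q hq =>
    (closure_minimal ht (hC t) (hDcl hq)).2
  classical
  refine ⟨fun q => if q i ≤ c then s₁ q else t +ᵥ s₂ q, ?_, fun q hq => ?_⟩
  · have hu : Icc a b = Icc a (Function.update b i c) ∪ Icc (Function.update a i c) b := by
      ext q
      rw [mem_union, mem₁, mem₂]
      have := le_total (q i) c
      tauto
    rw [hu]
    refine ContinuousOn.union_of_isClosed (hs₁.congr fun q hq => ?_)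
      ((hs₂.const_vadd t).congr fun q hq => ?_) isClosed_Icc isClosed_Icc
    · exact if_pos ((mem₁ q).1 hq).2
    · obtain ⟨hq', hc⟩ := (mem₂ q).1 hq
      by_cases h : q i ≤ c
      · exact (if_pos h).trans (hKt q ⟨hq', le_antisymm h hc⟩)
      · exact if_neg h
  · dsimp only
    split_ifs with h
    · exact hπ₁ q ((mem₁ q).2 ⟨hq, h⟩)
    · rw [hπ.vadd_eq]; exact hπ₂ q ((mem₂ q).2 ⟨hq, (not_le.1 h).le⟩)

/-- Sections over all small boxes give a section over every box, one coordinate at a time. -/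
theorem hasSectionOn_Icc_of_small (hπ : IsCubeOrbitMap π) {δ : ℝ} (hδ : 0 < δ)
    (h : ∀ a b : UnitCube n, (∀ j, a j < b j) → (∀ j, (b j : ℝ) - a j < δ) →
      HasSectionOn π (Icc a b)) (S : Finset (Fin n)) :
    ∀ a b : UnitCube n, (∀ j, a j < b j) → (∀ j ∉ S, (b j : ℝ) - a j < δ) →
      HasSectionOn π (Icc a b) := by
  induction S using Finset.induction_on with
  | empty => exact fun a b hab hj => h a b hab fun j => hj j (by simp)
  | insert i S _ ih =>
    -- `S` holds the coordinates in which the box may be long. Halving the `i`-th side `k` times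
    -- brings it below `δ`, which reduces to the boxes handled for `S`.
    have key : ∀ k : ℕ, ∀ a b : UnitCube n, (∀ j, a j < b j) →
        (∀ j ∉ insert i S, (b j : ℝ) - a j < δ) → (b i : ℝ) - a i < 2 ^ k * δ →
        HasSectionOn π (Icc a b) := by
      intro k
      induction k with
      | zero =>
        intro a b hab hj hi
        refine ih a b hab fun j hjS => ?_
        by_cases hji : j = i
        · subst hji; simpa using hi
        · exact hj j (by simp [hji, hjS])
      | succ k ihk =>
        intro a b hab hj hi
        have hi' : (a i : ℝ) < b i := hab i
        let c : unitInterval := ⟨((a i : ℝ) + b i) / 2, by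
          have := (a i).2.1; have := (b i).2.1; linarith, by
          have := (a i).2.2; have := (b i).2.2; linarith⟩
        have hc : (c : ℝ) = ((a i : ℝ) + b i) / 2 := rfl
        have hac : a i < c := Subtype.coe_lt_coe.1 (by rw [hc]; linarith)
        have hcb : c < b i := Subtype.coe_lt_coe.1 (by rw [hc]; linarith)
        rw [pow_succ] at hi
        refine hπ.hasSectionOn_Icc_of_split hab hac hcb (ihk _ _ ?_ ?_ ?_) (ihk _ _ ?_ ?_ ?_)
        · intro j
          by_cases hji : j = i
          · subst hji; simpa using hac
          · simpa [hji] using hab j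
        · intro j hjS
          have hji : j ≠ i := by rintro rfl; simp at hjS
          simpa [hji] using hj j hjS
        · simp only [Function.update_self, hc]; linarith
        · intro j
          by_cases hji : j = i
          · subst hji; simpa using hcb
          · simpa [hji] using hab j
        · intro j hjS
          have hji : j ≠ i := by rintro rfl; simp at hjS
          simpa [hji] using hj j hjS
        · simp only [Function.update_self, hc]; linarith
    intro a b hab hj
    obtain ⟨k, hk⟩ := pow_unbounded_of_one_lt (((b i : ℝ) - a i) / δ) (one_lt_two (α := ℝ))
    exact key k a b hab hj ((div_lt_iff₀ hδ).1 hk)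

/-- An orbit map onto the cube with local sections has a global section. -/
theorem exists_section (hπ : IsCubeOrbitMap π)
    (hloc : ∀ q, ∃ U, IsOpen U ∧ q ∈ U ∧ HasSectionOn π U) :
    ∃ s : UnitCube n → X, Continuous s ∧ ∀ q, π (s q) = q := by
  choose U hU hqU hsU using hloc
  obtain ⟨δ, hδ, hball⟩ := lebesgue_number_lemma_of_metric (isCompact_univ (X := UnitCube n)) hU
    (fun q _ => mem_iUnion.2 ⟨q, hqU q⟩)
  have hsmall : ∀ a b : UnitCube n, (∀ j, a j < b j) → (∀ j, (b j : ℝ) - a j < δ) →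
      HasSectionOn π (Icc a b) := by
    intro a b _ hδab
    obtain ⟨p, hp⟩ := hball a trivial
    refine (hsU p).mono (Subset.trans (fun q hq => ?_) hp)
    rw [Metric.mem_ball, dist_pi_lt_iff hδ]
    intro j
    have h1 : (a j : ℝ) ≤ q j := hq.1 j
    have h2 : (q j : ℝ) ≤ b j := hq.2 j
    rw [Subtype.dist_eq, Real.dist_eq, abs_of_nonneg (by linarith)]
    linarith [hδab j]
  obtain ⟨s, hs, hπs⟩ := hπ.hasSectionOn_Icc_of_small hδ hsmall Finset.univ 0 1
    (fun j => zero_lt_one) (by simp)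
  have : Icc (0 : UnitCube n) 1 = univ :=
    eq_univ_of_forall fun q => ⟨fun j => unitInterval.nonneg', fun j => unitInterval.le_one'⟩
  rw [this] at hs hπs
  exact ⟨s, continuousOn_univ.1 hs, fun q => hπs q trivial⟩

end IsCubeOrbitMap

/-! ### Isotropy groups and the characteristic function -/

theorem stdReflect_eq_self_iff {n : ℕ} (t : Z2Pow n) (v : EuclideanSpace ℝ (Fin n)) :
    stdReflect t v = v ↔ ∀ i, v i ≠ 0 → t i = 0 := by
  have : stdReflect t v = v ↔ ∀ i, stdReflect t v i = v i :=
    ⟨fun h i => by rw [h], fun h => by ext i; exact h i⟩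
  rw [this]
  refine forall_congr' fun i => ?_
  unfold stdReflect
  by_cases h : t i = 0
  · simp [h]
  · simp [h, neg_eq_self]

theorem Z2Pow.eq_zero_or_eq_single {n : ℕ} (i : Fin n) (w : Z2Pow n)
    (hw : ∀ j, j ≠ i → w j = 0) : w = 0 ∨ w = Pi.single i 1 := by
  have hi : w i = 0 ∨ w i = 1 := by generalize w i = z; revert z; decide
  refine hi.imp (fun h => ?_) fun h => ?_ <;> ext j <;> by_cases hj : j = i
  · subst hj; simpa using h
  · simpa using hw j hj
  · subst hj; simpa using h
  · simpa [hj] using hw j hj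

namespace IsCubeOrbitMap

variable {n : ℕ} {X : Type*} [TopologicalSpace X] [AddAction (Z2Pow n) X] {π : X → UnitCube n}

/-- Both sides say that the isotropy group has order 2, that is, that the codimension is 1. This
detects relative interiors of facets from the action alone. -/
theorem existsUnique_vadd_eq_iff (hπ : IsCubeOrbitMap π) (x : X) :
    (∃! t : Z2Pow n, t ≠ 0 ∧ t +ᵥ x = x) ↔ ∃ i, ∀ j, (π x j = 0 ∨ π x j = 1) ↔ j = i := by
  have h1 : (∃! t : Z2Pow n, t ≠ 0 ∧ t +ᵥ x = x) ↔
      Nat.card (AddAction.stabilizer (Z2Pow n) x) = 2 := by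
    rw [Nat.card_eq_two_iff' 0]
    constructor
    · rintro ⟨t, ⟨ht, htx⟩, hu⟩
      exact ⟨⟨t, htx⟩, fun h => ht (congrArg Subtype.val h),
        fun t' ht' => Subtype.ext (hu _ ⟨fun h => ht' (Subtype.ext h), t'.2⟩)⟩
    · rintro ⟨⟨t, htx⟩, ht, hu⟩
      exact ⟨t, ⟨fun h => ht (Subtype.ext h), htx⟩, fun t' ht' =>
        congrArg Subtype.val (hu ⟨t', ht'.2⟩ fun h => ht'.1 (congrArg Subtype.val h))⟩
  have h2 : ∀ k : ℕ, 2 ^ k = 2 ↔ k = 1 := fun k =>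
    ⟨fun h => Nat.pow_right_injective le_rfl (h.trans (pow_one 2).symm), fun h => by simp [h]⟩
  rw [h1, hπ.card_stabilizer, h2, UnitCube.codim, ncard_eq_one]
  simp only [Set.ext_iff, mem_ofPred_eq, mem_singleton_iff]

variable [T2Space X] [ContinuousConstVAdd (Z2Pow n) X]

/-- The isotropy group is constant on the relative interior of a facet. -/
theorem exists_facet_isotropy (hπ : IsCubeOrbitMap π) {s : UnitCube n → X} (hs : Continuous s)
    (hπs : ∀ q, π (s q) = q) (i : Fin n) {ε : unitInterval} (hε : ε = 0 ∨ ε = 1) :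
    ∃ l : Z2Pow n, (∀ q, q i = ε → l +ᵥ s q = s q) ∧
      ∀ q, q i = ε → (∀ j, (q j = 0 ∨ q j = 1) ↔ j = i) →
        ∀ t : Z2Pow n, t ≠ 0 → t +ᵥ s q = s q → t = l := by
  let D : Set (UnitCube n) := univ.pi fun j => if j = i then {ε} else Ioo 0 1
  have hDpre : IsPreconnected D := isPreconnected_univ_pi fun j => by
    split_ifs
    · exact isPreconnected_singleton
    · exact isPreconnected_Ioo
  have hDne : D.Nonempty := univ_pi_nonempty_iff.2 fun j => by
    split_ifs
    · exact singleton_nonempty _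
    · exact nonempty_Ioo.2 zero_lt_one
  have hDcl : ∀ q : UnitCube n, q i = ε → q ∈ closure D := by
    intro q hqi
    rw [closure_pi_set]
    intro j _
    dsimp only
    split_ifs with hj
    · subst hj; simp [hqi]
    · rw [closure_Ioo zero_ne_one]; exact ⟨unitInterval.nonneg', unitInterval.le_one'⟩
  have hDmem : ∀ q, q i = ε → (∀ j, (q j = 0 ∨ q j = 1) ↔ j = i) → q ∈ D := by
    intro q hqi hq j _
    dsimp only
    split_ifs with hj
    · subst hj; simp [hqi]
    · have := mt (hq j).1 hj
      rw [not_or] at this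
      exact ⟨unitInterval.pos_iff_ne_zero.2 this.1, unitInterval.lt_one_iff_ne_one.2 this.2⟩
  have hDone : ∀ q ∈ D, ∃! t : Z2Pow n, t ≠ 0 ∧ t +ᵥ s q = s q := by
    intro q hq
    rw [hπ.existsUnique_vadd_eq_iff, hπs]
    refine ⟨i, fun j => ?_⟩
    by_cases hj : j = i
    · subst hj
      have : q j = ε := by simpa using hq j trivial
      simpa [this] using hε
    · have : q j ∈ Ioo 0 1 := by simpa [hj] using hq j trivial
      simp [hj, this.1.ne', this.2.ne]
  let C : {t : Z2Pow n // t ≠ 0} → Set (UnitCube n) := fun t => {q | t.1 +ᵥ s q = s q}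
  have hC : ∀ t, IsClosed (C t) := fun t => isClosed_eq (hs.const_vadd t.1) hs
  obtain ⟨l, hl⟩ := hDpre.exists_subset_of_finite_closed_cover hDne C hC
    (fun q hq => by
      obtain ⟨t, ht, -⟩ := hDone q hq
      exact ⟨⟨t, ht.1⟩, ht.2⟩)
    (fun q hq t t' ht ht' =>
      Subtype.ext ((hDone q hq).unique ⟨t.2, ht⟩ ⟨t'.2, ht'⟩))
  refine ⟨l, fun q hq => closure_minimal hl (hC l) (hDcl q hq), fun q hqi hq t ht htq => ?_⟩
  have hqD := hDmem q hqi hq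
  exact (hDone q hqD).unique ⟨ht, htq⟩ ⟨l.2, hl hqD⟩

/-- The isotropy group over `q` is generated by the isotropy groups of the facets through `q`. -/
theorem exists_characteristic
    [ChartedSpace (EuclideanSpace ℝ (Fin n)) X] (hloc : IsLocallyStandard n X)
    (hπ : IsCubeOrbitMap π) {s : UnitCube n → X} (hs : Continuous s)
    (hπs : ∀ q, π (s q) = q) :
    ∃ l : Fin n → unitInterval → Z2Pow n, ∀ q, AddAction.stabilizer (Z2Pow n) (s q) =
      AddSubgroup.closure {t | ∃ i, (q i = 0 ∨ q i = 1) ∧ t = l i (q i)} := by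
  have H : ∀ i : Fin n, ∀ ε : unitInterval, ∃ l : Z2Pow n, (ε = 0 ∨ ε = 1) →
      (∀ q : UnitCube n, q i = ε → l +ᵥ s q = s q) ∧
      ∀ q : UnitCube n, q i = ε → (∀ j, (q j = 0 ∨ q j = 1) ↔ j = i) →
        ∀ t : Z2Pow n, t ≠ 0 → t +ᵥ s q = s q → t = l := by
    intro i ε
    by_cases hε : ε = 0 ∨ ε = 1
    · obtain ⟨l, hl⟩ := hπ.exists_facet_isotropy hs hπs i hε
      exact ⟨l, fun _ => hl⟩
    -- A filler value: only `l i 0` and `l i 1` correspond to facets.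
    · exact ⟨0, fun h => absurd h hε⟩
  choose l hl using H
  refine ⟨l, fun q => le_antisymm ?_ ?_⟩
  swap
  · rw [AddSubgroup.closure_le]
    rintro _ ⟨i, hi, rfl⟩
    exact (hl i (q i) hi).1 q rfl
  obtain ⟨e, -, θ, hx, hsrc, htgt, heq⟩ := hloc (s q)
  have hfix : ∀ t, ∀ y ∈ e.source, t +ᵥ y = y ↔ ∀ i, e y i ≠ 0 → θ t i = 0 := by
    intro t y hy
    rw [← stdReflect_eq_self_iff, ← heq t y hy]
    exact (e.injOn.eq_iff (hsrc t y hy) hy).symm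
  -- In the chart, the isotropy at `s q` is generated by the reflections in the vanishing
  -- coordinates. Each of them is shown to be a facet vector by moving to a nearby point that only
  -- this reflection fixes.
  have key : ∀ i, e (s q) i = 0 → θ.symm (Pi.single i 1) ∈
      AddSubgroup.closure {t | ∃ i, (q i = 0 ∨ q i = 1) ∧ t = l i (q i)} := by
    intro i hi
    classical
    -- Moving along `d` makes every vanishing coordinate except the `i`-th nonzero.
    let d : EuclideanSpace ℝ (Fin n) :=
      WithLp.toLp 2 fun j => if j ≠ i ∧ e (s q) j = 0 then 1 else 0
    let γ : ℝ → EuclideanSpace ℝ (Fin n) := fun δ => e (s q) + δ • d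
    have hγ : Continuous γ := by fun_prop
    have hγ0 : γ 0 = e (s q) := by simp [γ]
    have hγt : ∀ᶠ δ in 𝓝 (0 : ℝ), γ δ ∈ e.target :=
      hγ.continuousAt.eventually_mem
        (by rw [hγ0]; exact e.open_target.mem_nhds (e.map_source hx))
    have hcont : ContinuousAt (fun δ => π (e.symm (γ δ))) 0 := by
      refine hπ.isOpenQuotientMap.continuous.continuousAt.comp ?_
      refine ContinuousAt.comp ?_ hγ.continuousAt
      rw [hγ0]
      exact e.continuousAt_symm (e.map_source hx)
    have hq0 : π (e.symm (γ 0)) = q := by rw [hγ0, e.left_inv hx, hπs]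
    -- For small `δ` no new facets appear: each facet through the perturbed orbit already passes
    -- through `q`.
    have hne : ∀ ε : unitInterval, ∀ᶠ δ in 𝓝 (0 : ℝ),
        ∀ j, q j ≠ ε → π (e.symm (γ δ)) j ≠ ε := by
      intro ε
      rw [Filter.eventually_all]
      intro j
      by_cases h : q j = ε
      · simp [h]
      · have : ContinuousAt (fun δ => π (e.symm (γ δ)) j) 0 :=
          (continuous_apply j).continuousAt.comp hcont
        have h' : π (e.symm (γ 0)) j ≠ ε := by rwa [hq0]
        filter_upwards [this.eventually_ne h'] with δ hδ _ using hδ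
    have hev : ∀ᶠ δ in 𝓝[>] (0 : ℝ), 0 < δ ∧ γ δ ∈ e.target ∧
        (∀ j, q j ≠ 0 → π (e.symm (γ δ)) j ≠ 0) ∧ (∀ j, q j ≠ 1 → π (e.symm (γ δ)) j ≠ 1) := by
      filter_upwards [self_mem_nhdsWithin, hγt.filter_mono nhdsWithin_le_nhds,
        (hne 0).filter_mono nhdsWithin_le_nhds, (hne 1).filter_mono nhdsWithin_le_nhds]
        with δ h1 h2 h3 h4 using ⟨h1, h2, h3, h4⟩
    obtain ⟨δ, hδ, hδt, hδ0, hδ1⟩ := hev.exists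
    set y := e.symm (γ δ) with hy
    have hys : y ∈ e.source := e.map_target hδt
    have hey : e y = γ δ := e.right_inv hδt
    have hyi : e y i = 0 := by simp [hey, γ, d, hi]
    have hyj : ∀ j, j ≠ i → e y j ≠ 0 := by
      intro j hj
      rw [hey]
      by_cases h : e (s q) j = 0
      · simpa [γ, d, hj, h] using hδ.ne'
      · simp [γ, d, h]
    have hfixy : ∀ t, t +ᵥ y = y ↔ ∀ j, j ≠ i → θ t j = 0 := by
      intro t
      rw [hfix t y hys]
      exact ⟨fun h j hj => h j (hyj j hj), fun h j hj => h j fun hji => hj (hji ▸ hyi)⟩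
    have htne : θ.symm (Pi.single i 1) ≠ 0 := by simp
    have hty : θ.symm (Pi.single i 1) +ᵥ y = y := by
      rw [hfixy]
      intro j hj
      simp [hj]
    obtain ⟨j, hj⟩ := (hπ.existsUnique_vadd_eq_iff y).1 ⟨θ.symm (Pi.single i 1), ⟨htne, hty⟩, by
      rintro t ⟨ht, hty'⟩
      rcases Z2Pow.eq_zero_or_eq_single i (θ t) ((hfixy t).1 hty') with h | h
      · exact absurd (by simpa using h) ht
      · rw [← h, θ.symm_apply_apply]⟩
    have hqj : q j = π y j := by
      rcases (hj j).2 rfl with h | h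
      · rw [h]; by_contra hq; exact hδ0 j hq h
      · rw [h]; by_contra hq; exact hδ1 j hq h
    -- The group is commutative, so `y` and its translate `s (π y)` have the same isotropy.
    obtain ⟨r, hr⟩ := (hπ.eq_iff (s (π y)) y).1 (hπs _)
    have := (hl j (π y j) ((hj j).2 rfl)).2 (π y) rfl hj _ htne (by
      rw [← hr, vadd_comm, hty])
    refine AddSubgroup.subset_closure ⟨j, ?_, ?_⟩
    · rw [hqj]; exact (hj j).2 rfl
    · rw [hqj]; exact this
  intro t ht
  have ht' := (hfix t (s q) hx).1 ht
  have : t = ∑ i, θ.symm (Pi.single i (θ t i)) := by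
    rw [← map_sum, Finset.univ_sum_single, θ.symm_apply_apply]
  rw [this]
  refine AddSubgroup.sum_mem _ fun i _ => ?_
  by_cases h : θ t i = 0
  · simp [h]
  · have h1 : θ t i = 1 := by
      revert h; generalize θ t i = z; revert z; decide
    rw [h1]
    exact key i (not_imp_comm.1 (ht' i) h)

end IsCubeOrbitMap

/-! ### Acyclic digraphs and matrices over `ZMod 2` -/

/-- A finite digraph is acyclic if no nonempty set of nodes induces a subgraph in which every
out-degree is one. -/
theorem Digraph.isAcyclic_of_exists_not_existsUnique {V : Type*} [Finite V] (G : Digraph V)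
    (h : ∀ S : Finset V, S.Nonempty → ∃ i ∈ S, ¬ ∃! j, j ∈ S ∧ G.Adj i j) : G.IsAcyclic := by
  classical
  have := Fintype.ofFinite V
  intro v hv
  let P : Set (Finset V) := {S | S.Nonempty ∧ ∀ i ∈ S, ∃ j ∈ S, G.Adj i j}
  have hP : P.Nonempty := by
    -- If `v` lies on a cycle, every node that reaches `v` has a successor that also reaches `v`.
    refine ⟨Finset.univ.filter fun w => Relation.TransGen G.Adj w v, ⟨v, by simpa using hv⟩, ?_⟩
    intro i hi
    simp only [Finset.mem_filter, Finset.mem_univ, true_and] at hi ⊢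
    obtain ⟨j, hij, hj⟩ := Relation.TransGen.head'_iff.1 hi
    rcases Relation.reflTransGen_iff_eq_or_transGen.1 hj with rfl | hj
    · exact ⟨_, hv, hij⟩
    · exact ⟨j, hj, hij⟩
  obtain ⟨S, ⟨hne, hS⟩, hmin⟩ := wellFounded_lt.has_min P hP
  -- The image of a successor function on `S` is again closed under having successors, so by
  -- minimality it is all of `S`. Hence every successor function permutes `S`.
  have himg : ∀ f : V → V, (∀ i ∈ S, f i ∈ S ∧ G.Adj i (f i)) → S.image f = S := by
    intro f hf
    have hsub : S.image f ⊆ S := Finset.image_subset_iff.2 fun i hi => (hf i hi).1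
    by_contra hne'
    refine hmin (S.image f) ⟨hne.image f, fun i hi => ?_⟩ (lt_of_le_of_ne hsub hne')
    exact ⟨f i, Finset.mem_image_of_mem f (hsub hi), (hf i (hsub hi)).2⟩
  have hinj : ∀ f : V → V, (∀ i ∈ S, f i ∈ S ∧ G.Adj i (f i)) → Set.InjOn f S := fun f hf =>
    Finset.card_image_iff.1 (by rw [himg f hf])
  have hex : ∀ i, ∃ j, i ∈ S → j ∈ S ∧ G.Adj i j := by
    intro i
    by_cases hi : i ∈ S
    · obtain ⟨j, hj⟩ := hS i hi
      exact ⟨j, fun _ => hj⟩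
    · exact ⟨i, fun h => absurd h hi⟩
  choose f hf using hex
  obtain ⟨i, hi, hnu⟩ := h S hne
  obtain ⟨a, ha, hia, haf⟩ : ∃ a ∈ S, G.Adj i a ∧ a ≠ f i := by
    by_contra hcon
    push Not at hcon
    exact hnu ⟨f i, hf i hi, fun a ha => hcon a ha.1 ha.2⟩
  obtain ⟨j, hj, hja⟩ := Finset.mem_image.1 ((himg f hf).symm ▸ ha)
  have hji : j ≠ i := by rintro rfl; exact haf hja.symm
  -- If `i` had a second successor `a = f j`, redirecting `i` to `a` would give a successor function
  -- that takes the value `a` at both `i` and `j`.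
  refine hji (hinj (Function.update f i a) (fun k hk => ?_) hj hi ?_)
  · by_cases hki : k = i
    · subst hki; simpa using ⟨ha, hia⟩
    · simpa [hki] using hf k hk
  · simp [hji, hja]

section Matrix

variable {n : ℕ} {b c : Fin n → Z2Pow n}

/-- If all these row sums vanished, the sum of the `c j` over `S` would lie in the span of the `b j`
with `j ∉ S`. The family mixed along `S` would then be dependent, although it consists of `n`
vectors spanning a space of dimension `n`. -/
theorem Module.Basis.exists_sum_repr_ne_zero (B : Module.Basis (Fin n) (ZMod 2) (Z2Pow n))
    (hB : ∀ i, B i = b i)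
    (hspan : ∀ S : Finset (Fin n),
      ⊤ ≤ Submodule.span (ZMod 2) (range fun i => if i ∈ S then c i else b i))
    {S : Finset (Fin n)} (hS : S.Nonempty) : ∃ i ∈ S, ∑ j ∈ S, B.repr (c j) i ≠ 0 := by
  by_contra! hcon
  have hli := linearIndependent_of_top_le_span_of_card_eq_finrank (hspan S) (by simp)
  have hcon' : ∀ i ∈ S, B.repr (∑ j ∈ S, c j) i = 0 := by
    intro i hi
    rw [map_sum, Finsupp.finsetSum_apply]
    exact hcon i hi
  have hsum : ∑ j, (if j ∈ S then 1 else -B.repr (∑ k ∈ S, c k) j) •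
      (if j ∈ S then c j else b j) = 0 := by
    have h1 : ∀ j, (if j ∈ S then (1 : ZMod 2) else -B.repr (∑ k ∈ S, c k) j) •
        (if j ∈ S then c j else b j) =
        (if j ∈ S then c j else 0) - B.repr (∑ k ∈ S, c k) j • B j := by
      intro j
      by_cases hj : j ∈ S
      · rw [if_pos hj, if_pos hj, if_pos hj, hcon' j hj, one_smul, zero_smul, sub_zero]
      · rw [if_neg hj, if_neg hj, if_neg hj, hB, neg_smul, zero_sub]
    rw [Finset.sum_congr rfl fun j _ => h1 j, Finset.sum_sub_distrib, B.sum_repr]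
    simp
  obtain ⟨i, hi⟩ := hS
  have := Fintype.linearIndependent_iff.1 hli _ hsum i
  simp [hi] at this

theorem Module.Basis.repr_self_eq_one (B : Module.Basis (Fin n) (ZMod 2) (Z2Pow n))
    (hB : ∀ i, B i = b i)
    (hspan : ∀ S : Finset (Fin n),
      ⊤ ≤ Submodule.span (ZMod 2) (range fun i => if i ∈ S then c i else b i)) (i : Fin n) :
    B.repr (c i) i = 1 := by
  obtain ⟨j, hj, h⟩ := B.exists_sum_repr_ne_zero hB hspan (Finset.singleton_nonempty i)
  rw [Finset.mem_singleton.1 hj, Finset.sum_singleton] at h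
  revert h
  generalize B.repr (c i) i = z
  revert z
  decide

/-- The digraph whose adjacency matrix is the off-diagonal part of the matrix of the vectors `c` in
the basis `B`. -/
def Module.Basis.digraph (B : Module.Basis (Fin n) (ZMod 2) (Z2Pow n))
    (c : Fin n → Z2Pow n) : Digraph (Fin n) where
  Adj i j := i ≠ j ∧ B.repr (c j) i ≠ 0

/-- If every node of `S` had exactly one successor in `S`, each row of the matrix restricted to `S`
would contain just that entry and the diagonal 1, so its sum would be `1 + 1 = 0`. -/
theorem Module.Basis.isAcyclic_digraph (B : Module.Basis (Fin n) (ZMod 2) (Z2Pow n))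
    (hB : ∀ i, B i = b i)
    (hspan : ∀ S : Finset (Fin n),
      ⊤ ≤ Submodule.span (ZMod 2) (range fun i => if i ∈ S then c i else b i)) :
    (B.digraph c).IsAcyclic := by
  refine Digraph.isAcyclic_of_exists_not_existsUnique _ fun S hS => ?_
  obtain ⟨i, hi, hsum⟩ := B.exists_sum_repr_ne_zero hB hspan hS
  refine ⟨i, hi, ?_⟩
  rintro ⟨j, ⟨hj, hij, hAij⟩, hu⟩
  refine hsum ?_
  have h1 : ∑ k ∈ ({i, j} : Finset (Fin n)), B.repr (c k) i = ∑ k ∈ S, B.repr (c k) i := by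
    refine Finset.sum_subset ?_ fun k hk hk' => ?_
    · simp [Finset.insert_subset_iff, hi, hj]
    · simp only [Finset.mem_insert, Finset.mem_singleton, not_or] at hk'
      by_contra hne
      exact hk'.2 (hu k ⟨hk, Ne.symm hk'.1, hne⟩)
  rw [← h1, Finset.sum_pair hij, B.repr_self_eq_one hB hspan]
  revert hAij
  generalize B.repr (c j) i = z
  revert z
  decide

end Matrix

/-! ### Reconstruction of the space from its isotropy groups -/

namespace IsCubeOrbitMap

variable {n : ℕ} {X : Type*} [TopologicalSpace X] [T2Space X] [AddAction (Z2Pow n) X]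
  [ContinuousConstVAdd (Z2Pow n) X] {π : X → UnitCube n}

/-- A map from the section extends to an equivariant map if it respects isotropy groups. -/
theorem exists_equivariant_extension (hπ : IsCubeOrbitMap π) {s : UnitCube n → X}
    (hs : Continuous s) (hπs : ∀ q, π (s q) = q) {Y : Type*} [TopologicalSpace Y]
    [AddAction (Z2Pow n) Y] [ContinuousConstVAdd (Z2Pow n) Y] {s' : UnitCube n → Y}
    (hs' : Continuous s') (φ : Z2Pow n →+ Z2Pow n)
    (h : ∀ q, ∀ t : Z2Pow n, t +ᵥ s q = s q → φ t +ᵥ s' q = s' q) :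
    ∃ f : X → Y, Continuous f ∧ ∀ (t : Z2Pow n) (q : UnitCube n), f (t +ᵥ s q) = φ t +ᵥ s' q := by
  have hτ : ∀ x, ∃ t : Z2Pow n, t +ᵥ s (π x) = x := fun x => (hπ.eq_iff _ _).1 (hπs _).symm
  choose τ hτ using hτ
  have hf : ∀ (t : Z2Pow n) (x : X), t +ᵥ s (π x) = x →
      φ (τ x) +ᵥ s' (π x) = φ t +ᵥ s' (π x) := by
    intro t x ht
    have := h (π x) (-t + τ x) (by rw [add_vadd, hτ, neg_vadd_eq_iff, ht])
    rwa [map_add, map_neg, add_vadd, neg_vadd_eq_iff] at this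
  refine ⟨fun x => φ (τ x) +ᵥ s' (π x), ?_, fun t q => ?_⟩
  · have hc := hπ.isOpenQuotientMap.continuous
    -- The translates of the image of the section form a finite closed cover of `X`, and on each of
    -- them `τ` may be replaced by a constant.
    refine (locallyFinite_of_finite fun t : Z2Pow n => {x | t +ᵥ s (π x) = x}).continuous
      (eq_univ_of_forall fun x => mem_iUnion.2 ⟨τ x, hτ x⟩)
      (fun t => isClosed_eq ((hs.comp hc).const_vadd t) continuous_id) fun t => ?_
    exact ((hs'.comp hc).const_vadd (φ t)).continuousOn.congr fun x hx => hf t x hx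
  · have hq : π (t +ᵥ s q) = q := by rw [hπ.vadd_eq, hπs]
    have := hf t (t +ᵥ s q) (by rw [hq])
    dsimp only
    rw [hq] at this ⊢
    exact this

/-- Spaces over the cube whose isotropy groups correspond are weakly equivariantly homeomorphic. -/
theorem exists_homeomorph (hπ : IsCubeOrbitMap π) {s : UnitCube n → X}
    (hs : Continuous s) (hπs : ∀ q, π (s q) = q) {Y : Type*} [TopologicalSpace Y] [T2Space Y]
    [AddAction (Z2Pow n) Y] [ContinuousConstVAdd (Z2Pow n) Y] {π' : Y → UnitCube n}
    (hπ' : IsCubeOrbitMap π') {s' : UnitCube n → Y}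
    (hs' : Continuous s') (hπs' : ∀ q, π' (s' q) = q) (φ : Z2Pow n ≃+ Z2Pow n)
    (g : UnitCube n ≃ₜ UnitCube n)
    (h : ∀ q, (AddAction.stabilizer (Z2Pow n) (s q)).map φ.toAddMonoidHom =
      AddAction.stabilizer (Z2Pow n) (s' (g q))) :
    ∃ f : X ≃ₜ Y, ∀ (t : Z2Pow n) (x : X), f (t +ᵥ x) = φ t +ᵥ f x := by
  obtain ⟨f, hf, hfe⟩ := hπ.exists_equivariant_extension hs hπs (hs'.comp g.continuous)
    φ.toAddMonoidHom fun q t ht => by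
      have : φ t ∈ AddAction.stabilizer (Z2Pow n) (s' (g q)) := h q ▸ ⟨t, ht, rfl⟩
      exact this
  obtain ⟨f', hf', hfe'⟩ := hπ'.exists_equivariant_extension hs' hπs' (hs.comp g.symm.continuous)
    φ.symm.toAddMonoidHom fun q t ht => by
      have : t ∈ AddAction.stabilizer (Z2Pow n) (s' (g (g.symm q))) := by simpa using ht
      rw [← h] at this
      obtain ⟨r, hr, rfl⟩ := this
      simpa using hr
  have hx : ∀ x, ∃ (t : Z2Pow n) (q : UnitCube n), t +ᵥ s q = x := fun x =>
    let ⟨t, ht⟩ := (hπ.eq_iff _ _).1 (hπs (π x)).symm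
    ⟨t, _, ht⟩
  have hy : ∀ y, ∃ (t : Z2Pow n) (q : UnitCube n), t +ᵥ s' q = y := fun y =>
    let ⟨t, ht⟩ := (hπ'.eq_iff _ _).1 (hπs' (π' y)).symm
    ⟨t, _, ht⟩
  simp only [Function.comp_apply, AddEquiv.toAddMonoidHom_eq_coe, AddMonoidHom.coe_coe]
    at hfe hfe'
  refine ⟨⟨⟨f, f', fun x => ?_, fun y => ?_⟩, hf, hf'⟩, fun t x => ?_⟩
  · obtain ⟨t, q, rfl⟩ := hx x
    rw [hfe, hfe', φ.symm_apply_apply, g.symm_apply_apply]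
  · obtain ⟨t, q, rfl⟩ := hy y
    rw [hfe', hfe, φ.apply_symm_apply, g.apply_symm_apply]
  · obtain ⟨r, q, rfl⟩ := hx x
    change f _ = φ t +ᵥ f _
    rw [← add_vadd, hfe, hfe, map_add, add_vadd]

end IsCubeOrbitMap

/-! ### The digraph of a small cover -/

namespace SmallCover

variable {n : ℕ}

instance (M : SmallCover.{u} n) : ContinuousConstVAdd (Z2Pow n) M.carrier :=
  ⟨fun t => (M.smooth_vadd t).continuous⟩

/-- `l i ε` generates the isotropy group of the facet `q i = ε` with respect to some identification
of the orbit space with the cube and some section of the orbit map. -/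
def IsCharacteristic (M : SmallCover.{u} n) (l : Fin n → unitInterval → Z2Pow n) : Prop :=
  ∃ (π : M.carrier → UnitCube n) (s : UnitCube n → M.carrier), IsCubeOrbitMap π ∧ Continuous s ∧
    (∀ q, π (s q) = q) ∧ ∀ q, AddAction.stabilizer (Z2Pow n) (s q) =
      AddSubgroup.closure {t | ∃ i, (q i = 0 ∨ q i = 1) ∧ t = l i (q i)}

theorem exists_isCharacteristic (M : SmallCover.{u} n) : ∃ l, M.IsCharacteristic l := by
  obtain ⟨π, hπ⟩ := M.orbitSpace.exists_isCubeOrbitMap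
  obtain ⟨s, hs, hπs⟩ := hπ.exists_section (M.locallyStandard.exists_hasSectionOn hπ)
  obtain ⟨l, hl⟩ := hπ.exists_characteristic M.locallyStandard hs hπs
  exact ⟨l, π, s, hπ, hs, hπs, hl⟩

/-- The isotropy groups of the facets through a vertex of the cube generate `ℤ₂ⁿ`. -/
theorem IsCharacteristic.top_le_span {M : SmallCover.{u} n} {l : Fin n → unitInterval → Z2Pow n}
    (h : M.IsCharacteristic l) (S : Finset (Fin n)) :
    ⊤ ≤ Submodule.span (ZMod 2) (range fun i => if i ∈ S then l i 1 else l i 0) := by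
  obtain ⟨π, s, hπ, -, hπs, hl⟩ := h
  -- The vertex opposite to the origin exactly in the coordinates of `S`. Its isotropy group has
  -- order `2 ^ n`, so it is everything.
  let q : UnitCube n := fun i => if i ∈ S then 1 else 0
  have hq : ∀ i, q i = 0 ∨ q i = 1 := fun i => by by_cases hi : i ∈ S <;> simp [q, hi]
  have hcard := hπ.card_stabilizer (s q)
  have hcodim : q.codim = n := by
    rw [UnitCube.codim, show {i | q i = 0 ∨ q i = 1} = univ from eq_univ_of_forall hq,
      ncard_univ, Nat.card_fin]
  rw [hπs, hcodim] at hcard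
  have htop : AddAction.stabilizer (Z2Pow n) (s q) = ⊤ :=
    AddSubgroup.eq_top_of_card_eq _ (by rw [hcard]; simp)
  intro t _
  have ht : t ∈ AddSubgroup.closure {t | ∃ i, (q i = 0 ∨ q i = 1) ∧ t = l i (q i)} := by
    rw [← hl q, htop]; trivial
  refine (AddSubgroup.closure_le (Submodule.span (ZMod 2) _).toAddSubgroup).2 ?_ ht
  rintro _ ⟨i, -, rfl⟩
  refine Submodule.subset_span ⟨i, ?_⟩
  by_cases hi : i ∈ S <;> simp [q, hi]

/-- `G` is the digraph of the characteristic matrix of `M` with respect to the facets through the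
origin. -/
def HasDigraph (M : SmallCover.{u} n) (G : Digraph (Fin n)) : Prop :=
  ∃ (l : Fin n → unitInterval → Z2Pow n) (B : Module.Basis (Fin n) (ZMod 2) (Z2Pow n)),
    M.IsCharacteristic l ∧ (∀ i, B i = l i 0) ∧ G = B.digraph fun i => l i 1

theorem exists_hasDigraph (M : SmallCover.{u} n) :
    ∃ G : {G : Digraph (Fin n) // G.IsAcyclic}, M.HasDigraph G := by
  obtain ⟨l, hl⟩ := M.exists_isCharacteristic
  have h0 : ⊤ ≤ Submodule.span (ZMod 2) (range fun i => l i 0) := by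
    simpa using hl.top_le_span ∅
  let B := basisOfTopLeSpanOfCardEqFinrank (fun i => l i 0) h0 (by simp)
  have hB : ∀ i, B i = l i 0 := fun i => by simp [B]
  exact ⟨⟨_, B.isAcyclic_digraph (c := fun i => l i 1) hB hl.top_le_span⟩, l, B, hl, hB, rfl⟩

/-- Small covers with isomorphic digraphs are weakly equivariantly homeomorphic. -/
theorem HasDigraph.weaklyHomeomorphic {M N : SmallCover.{u} n} {G H : Digraph (Fin n)}
    (hM : M.HasDigraph G) (hN : N.HasDigraph H) (σ : G.Adj ≃r H.Adj) : M.WeaklyHomeomorphic N := by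
  obtain ⟨l, B, hl, hB, rfl⟩ := hM
  obtain ⟨l', B', hl', hB', rfl⟩ := hN
  have hd := B.repr_self_eq_one hB hl.top_le_span
  have hd' := B'.repr_self_eq_one hB' hl'.top_le_span
  obtain ⟨π, s, hπ, hs, hπs, hst⟩ := hl
  obtain ⟨π', s', hπ', hs', hπs', hst'⟩ := hl'
  -- The automorphism permutes basis vectors by `σ`, as `g` below permutes the coordinates of the
  -- cube, so facets and their vectors are carried along together.
  let φ := B.equiv B' σ.toEquiv
  have hrepr : ∀ v i, B'.repr (φ v) (σ i) = B.repr v i := by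
    intro v i
    have h : (B'.reindex σ.toEquiv.symm).repr (φ v) = B.repr v :=
      LinearEquiv.apply_symm_apply _ _
    rw [← h, Module.Basis.repr_reindex_apply]
    rfl
  have hφ0 : ∀ i, φ (l i 0) = l' (σ i) 0 := by
    intro i
    rw [← hB, ← hB']
    exact B.equiv_apply i B' σ.toEquiv
  have hφ1 : ∀ i, φ (l i 1) = l' (σ i) 1 := by
    intro j
    apply B'.repr.injective
    ext k
    obtain ⟨i, rfl⟩ := σ.surjective k
    rw [hrepr]
    -- Diagonal entries are 1 on both sides. Off the diagonal, adjacency tells whether an entry is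
    -- nonzero, which over `ZMod 2` determines it.
    by_cases hij : i = j
    · rw [hij, hd, hd']
    · have h1 : (σ i ≠ σ j ∧ B'.repr (l' (σ j) 1) (σ i) ≠ 0) ↔ (i ≠ j ∧ B.repr (l j 1) i ≠ 0) :=
        σ.map_rel_iff
      rw [and_iff_right (σ.injective.ne hij), and_iff_right hij] at h1
      revert h1
      generalize B.repr (l j 1) i = x
      generalize B'.repr (l' (σ j) 1) (σ i) = y
      revert x y
      decide
  have hφ : ∀ i ε, ε = 0 ∨ ε = 1 → φ (l i ε) = l' (σ i) ε := by
    rintro i ε (rfl | rfl)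
    exacts [hφ0 i, hφ1 i]
  let g : UnitCube n ≃ₜ UnitCube n :=
    Homeomorph.piCongrLeft (Y := fun _ => unitInterval) σ.toEquiv
  have hg : ∀ q i, g q (σ i) = q i := fun q i =>
    Equiv.piCongrLeft_apply_apply (fun _ => unitInterval) σ.toEquiv q i
  refine ⟨φ.toAddEquiv, hπ.exists_homeomorph hs hπs hπ' hs' hπs' φ.toAddEquiv g fun q => ?_⟩
  rw [hst, hst', AddMonoidHom.map_closure]
  congr 1
  ext t
  constructor
  · rintro ⟨_, ⟨i, hi, rfl⟩, rfl⟩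
    refine ⟨σ i, ?_, ?_⟩
    · rwa [hg]
    · rw [hg]; exact hφ i _ hi
  · rintro ⟨k, hk, rfl⟩
    obtain ⟨i, rfl⟩ := σ.surjective k
    rw [hg] at hk ⊢
    exact ⟨_, ⟨i, hk, rfl⟩, hφ i _ hk⟩

end SmallCover

instance (n : ℕ) : Finite (UnlabeledAcyclicDigraph n) := by
  have : Finite (Digraph (Fin n)) := Finite.of_injective Digraph.Adj fun G H h => Digraph.ext h
  exact Quotient.finite _

/-- The digraph may depend on the chosen orbit map and section, so it is taken for one
representative of each class. Injectivity does not need it to be an invariant. -/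
theorem exists_injective_smallCoverClass (n : ℕ) :
    ∃ F : SmallCoverClass.{u} n → UnlabeledAcyclicDigraph n, Function.Injective F := by
  choose G hG using fun M : SmallCover.{u} n => M.exists_hasDigraph
  refine ⟨fun c => Quotient.mk (acyclicDigraphSetoid n) (G (Quotient.out c)), fun c d h => ?_⟩
  obtain ⟨σ⟩ := Quotient.exact h
  rw [← Quotient.out_eq c, ← Quotient.out_eq d]
  exact Quotient.sound ((hG _).weaklyHomeomorphic (hG _) σ)

theorem mainTheorem4 (n : ℕ) :
    Finite (SmallCoverClass.{u} n) ∧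
      Nat.card (SmallCoverClass.{u} n) ≤ Nat.card (UnlabeledAcyclicDigraph n) := by
  obtain ⟨F, hF⟩ := exists_injective_smallCoverClass.{u} n
  exact ⟨Finite.of_injective F hF, Nat.card_le_card_of_injective F hF⟩
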